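/- Let $(\mathcal{C},\mathbb{E},\mathfrak{s})$ be an extriangulated category with enough $\mathbb{E}$-projectives and enough $\mathbb{E}$-injectives. For $k\ge 0$ let $\Omega^k M$ denote a $k$-th syzygy of $M$ (so $\Omega^0M=M$ and there are $\mathbb{E}$-triangles $\Omega^{k+1}M\to P\to\Omega^kM\dashrightarrow$ with $P$ an $\mathbb{E}$-projective object), and let $\mathbb{E}^{i}(M,N):=\mathbb{E}(\Omega^{i-1}M,N)$, $i\ge 1$, be the higher extension bifunctors of $\mathcal{C}$. Let $n\ge 0$ and let $\mathcal{X}\subseteq\mathcal{C}$ be a full subcategory such that * $\mathcal{X}$ is $(n+2)$-rigid, i.e. $\mathbb{E}^{j}(X,X')=0$ for all $X,X'\in\mathcal{X}$ and $1\le j\le n+1$; * $\mathcal{X}$ is functorially finite in $\mathcal{C}$, i.e. every object of $\mathcal{C}$ has a right and a left $\mathcal{X}$-approximation; * $\mathcal{X}^{\perp_{\le n+1}}={}^{\perp_{\le n+1}}\mathcal{X}$, where $\mathcal{X}^{\perp_{\le n+1}}=\{N : \mathbb{E}^{j}(X,N)=0 \text{ for all } X\in\mathcal{X},\ 1\le j\le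 n+1\}$ and ${}^{\perp_{\le n+1}}\mathcal{X}=\{M : \mathbb{E}^{j}(M,X)=0 \text{ for all } X\in\mathcal{X},\ 1\le j\le n+1\}$. Let $\mathcal{R}=\mathcal{R}^{n+1}_{\mathcal{C}}(\mathcal{X}):=\mathcal{X}^{\perp_{\le n+1}}={}^{\perp_{\le n+1}}\mathcal{X}$. Then $\mathcal{R}$, with the restrictions of $\mathbb{E}$ and $\mathfrak{s}$, is an extriangulated category with enough projectives, so that it has its own higher extension bifunctors $\mathbb{E}^{i}_{\mathcal{R}}$, formed with syzygies in $\mathcal{R}$; and for every $1\le i\le n+1$ there are isomorphisms of abelian groups $$\mathbb{E}^{i}_{\mathcal{R}}(M,N)\;\cong\;\mathbb{E}^{i}(M,N)\qquad\text{for all } M,N\in\mathcal{R},$$ natural in $M$ and $N$. -/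

import Mathlib

open CategoryTheory CategoryTheory.Limits Opposite
open scoped ZeroObject

universe w v u

noncomputable section

namespace Extri

/-- The data underlying an extriangulated category: a bifunctor `E` with values in abelian groups
and a relation `Realizes`. The realization `𝔰`, which sends an extension `δ ∈ E(Z, A)` to an
equivalence class of sequences `A ⟶ B ⟶ Z`, is encoded by its graph: `Realizes x y δ` says that
`𝔰(δ)` is the class of `A --x--> B --y--> Z`. The laws are in `IsExtriangulated`. -/
structure ExtriData (C : Type u) [Category.{v} C] where
  E : Cᵒᵖ ⥤ C ⥤ AddCommGrpCat.{w}
  Realizes : ∀ {A B Z : C}, (A ⟶ B) → (B ⟶ Z) → (E.obj (op Z)).obj A → Prop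

namespace ExtriData

variable {C : Type u} [Category.{v} C]

/-- The group `E(Z, A)` of extensions. -/
abbrev Ext (S : ExtriData.{w} C) (Z A : C) : Type w := (S.E.obj (op Z)).obj A

/-- `a · δ = E(Z, a)(δ)`. -/
def push (S : ExtriData.{w} C) {Z A A' : C} (a : A ⟶ A') (δ : S.Ext Z A) : S.Ext Z A' :=
  ((S.E.obj (op Z)).map a).hom δ

/-- `δ · c = E(c, A)(δ)`. -/
def pull (S : ExtriData.{w} C) {Z Z' A : C} (c : Z' ⟶ Z) (δ : S.Ext Z A) : S.Ext Z' A :=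
  ((S.E.map c.op).app A).hom δ

/-- `(E, 𝔰)` is an external triangulation of the additive category `C`. -/
class IsExtriangulated [Preadditive C] (S : ExtriData.{w} C) : Prop where
  /-- `C` is an additive category. -/
  hasFiniteBiproducts : HasFiniteBiproducts C
  /-- (ET1): `E` is additive in each variable. -/
  additive_left : S.E.Additive
  additive_right : ∀ Z : Cᵒᵖ, (S.E.obj Z).Additive
  /-- Every extension is realized by exactly one equivalence class of sequences. -/
  exists_realizes : ∀ {A Z : C} (δ : S.Ext Z A),
    ∃ (B : C) (x : A ⟶ B) (y : B ⟶ Z), S.Realizes x y δ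
  realizes_of_equiv : ∀ {A B B' Z : C} (x : A ⟶ B) (y : B ⟶ Z) (δ : S.Ext Z A) (b : B ≅ B'),
    S.Realizes x y δ → S.Realizes (x ≫ b.hom) (b.inv ≫ y) δ
  equiv_of_realizes : ∀ {A B B' Z : C} (x : A ⟶ B) (y : B ⟶ Z) (x' : A ⟶ B') (y' : B' ⟶ Z)
    (δ : S.Ext Z A), S.Realizes x y δ → S.Realizes x' y' δ →
    ∃ b : B ≅ B', x ≫ b.hom = x' ∧ b.hom ≫ y' = y
  /-- Morphisms of extensions are realized by morphisms of sequences. -/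
  exists_middle : ∀ {A B Z A' B' Z' : C} (x : A ⟶ B) (y : B ⟶ Z) (δ : S.Ext Z A)
    (x' : A' ⟶ B') (y' : B' ⟶ Z') (δ' : S.Ext Z' A') (a : A ⟶ A') (c : Z ⟶ Z'),
    S.Realizes x y δ → S.Realizes x' y' δ' → S.push a δ = S.pull c δ' →
    ∃ b : B ⟶ B', x ≫ b = a ≫ x' ∧ y ≫ c = b ≫ y'
  /-- (ET2), `𝔰(0)`: stated for every biproduct of `A` and `Z`. -/
  realizes_zero : ∀ {A Z : C} (b : BinaryBicone A Z), b.IsBilimit →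
    S.Realizes b.inl b.snd (0 : S.Ext Z A)
  /-- (ET2), `𝔰(δ ⊕ δ') = 𝔰(δ) ⊕ 𝔰(δ')`: stated for all biproducts of the terms. -/
  realizes_sum : ∀ {A B Z A' B' Z' : C} (x : A ⟶ B) (y : B ⟶ Z) (δ : S.Ext Z A)
    (x' : A' ⟶ B') (y' : B' ⟶ Z') (δ' : S.Ext Z' A')
    (bA : BinaryBicone A A') (bB : BinaryBicone B B') (bZ : BinaryBicone Z Z'),
    bA.IsBilimit → bB.IsBilimit → bZ.IsBilimit →
    S.Realizes x y δ → S.Realizes x' y' δ' →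
    S.Realizes (bA.fst ≫ x ≫ bB.inl + bA.snd ≫ x' ≫ bB.inr)
      (bB.fst ≫ y ≫ bZ.inl + bB.snd ≫ y' ≫ bZ.inr)
      (S.pull bZ.fst (S.push bA.inl δ) + S.pull bZ.snd (S.push bA.inr δ'))
  /-- (ET3). -/
  et3 : ∀ {A B Z A' B' Z' : C} (x : A ⟶ B) (y : B ⟶ Z) (δ : S.Ext Z A)
    (x' : A' ⟶ B') (y' : B' ⟶ Z') (δ' : S.Ext Z' A') (a : A ⟶ A') (b : B ⟶ B'),
    S.Realizes x y δ → S.Realizes x' y' δ' → x ≫ b = a ≫ x' →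
    ∃ c : Z ⟶ Z', S.push a δ = S.pull c δ' ∧ y ≫ c = b ≫ y'
  /-- (ET3)ᵒᵖ. -/
  et3op : ∀ {A B Z A' B' Z' : C} (x : A ⟶ B) (y : B ⟶ Z) (δ : S.Ext Z A)
    (x' : A' ⟶ B') (y' : B' ⟶ Z') (δ' : S.Ext Z' A') (b : B ⟶ B') (c : Z ⟶ Z'),
    S.Realizes x y δ → S.Realizes x' y' δ' → y ≫ c = b ≫ y' →
    ∃ a : A ⟶ A', S.push a δ = S.pull c δ' ∧ x ≫ b = a ≫ x'
  /-- (ET4). -/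
  et4 : ∀ {A B D G F : C} (f : A ⟶ B) (f' : B ⟶ D) (δ : S.Ext D A)
    (g : B ⟶ G) (g' : G ⟶ F) (δ' : S.Ext F B),
    S.Realizes f f' δ → S.Realizes g g' δ' →
    ∃ (H : C) (d : D ⟶ H) (e : H ⟶ F) (h' : G ⟶ H) (δ'' : S.Ext H A),
      f' ≫ d = g ≫ h' ∧ h' ≫ e = g' ∧
      S.Realizes (f ≫ g) h' δ'' ∧ S.Realizes d e (S.push f' δ') ∧
      S.pull d δ'' = δ ∧ S.push f δ'' = S.pull e δ'
  /-- (ET4)ᵒᵖ. -/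
  et4op : ∀ {A B D G F : C} (f' : D ⟶ A) (f : A ⟶ B) (δ : S.Ext B D)
    (g' : F ⟶ B) (g : B ⟶ G) (δ' : S.Ext G F),
    S.Realizes f' f δ → S.Realizes g' g δ' →
    ∃ (H : C) (d : D ⟶ H) (e : H ⟶ F) (h' : H ⟶ A) (δ'' : S.Ext G H),
      d ≫ h' = f' ∧ h' ≫ f = e ≫ g' ∧
      S.Realizes h' (f ≫ g) δ'' ∧ S.Realizes d e (S.pull g' δ) ∧
      S.push e δ'' = δ' ∧ S.push d δ = S.pull g δ''

/-- `P` is `E`-projective. -/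
def IsProjective (S : ExtriData.{w} C) (P : C) : Prop :=
  ∀ {A B Z : C} (x : A ⟶ B) (y : B ⟶ Z) (δ : S.Ext Z A), S.Realizes x y δ →
    ∀ f : P ⟶ Z, ∃ g : P ⟶ B, g ≫ y = f

/-- `I` is `E`-injective. -/
def IsInjective (S : ExtriData.{w} C) (I : C) : Prop :=
  ∀ {A B Z : C} (x : A ⟶ B) (y : B ⟶ Z) (δ : S.Ext Z A), S.Realizes x y δ →
    ∀ f : A ⟶ I, ∃ g : B ⟶ I, x ≫ g = f

/-- An `E`-triangle `K ⟶ P ⟶ M ⇢` with `P` projective, so that `K` is a syzygy of `M`. -/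
structure ProjPresentation (S : ExtriData.{w} C) (M : C) where
  K : C
  P : C
  i : K ⟶ P
  p : P ⟶ M
  δ : S.Ext M K
  realizes : S.Realizes i p δ
  projective : S.IsProjective P

/-- Enough `E`-projectives. -/
class HasEnoughProjectives (S : ExtriData.{w} C) : Prop where
  presentation : ∀ M : C, Nonempty (S.ProjPresentation M)

/-- Enough `E`-injectives. -/
class HasEnoughInjectives (S : ExtriData.{w} C) : Prop where
  presentation : ∀ M : C, ∃ (I L : C) (x : M ⟶ I) (y : I ⟶ L) (δ : S.Ext L M),
    S.Realizes x y δ ∧ S.IsInjective I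

section pushpull

variable (S : ExtriData.{w} C)

lemma push_id {Z A : C} (δ : S.Ext Z A) : S.push (𝟙 A) δ = δ := by simp [push]

lemma push_comp {Z A A' A'' : C} (a : A ⟶ A') (a' : A' ⟶ A'') (δ : S.Ext Z A) :
    S.push (a ≫ a') δ = S.push a' (S.push a δ) := by simp [push]

lemma pull_id {Z A : C} (δ : S.Ext Z A) : S.pull (𝟙 Z) δ = δ := by simp [pull]

lemma pull_comp {Z Z' Z'' A : C} (c' : Z'' ⟶ Z') (c : Z' ⟶ Z) (δ : S.Ext Z A) :
    S.pull (c' ≫ c) δ = S.pull c' (S.pull c δ) := by simp [pull]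

lemma push_pull {Z Z' A A' : C} (a : A ⟶ A') (c : Z' ⟶ Z) (δ : S.Ext Z A) :
    S.push a (S.pull c δ) = S.pull c (S.push a δ) := by
  have := (S.E.map c.op).naturality a
  exact (congrArg (fun f => AddCommGrpCat.Hom.hom f δ) this).symm

lemma push_zero {Z A A' : C} (a : A ⟶ A') : S.push a (0 : S.Ext Z A) = 0 := by simp [push]

lemma pull_zero {Z Z' A : C} (c : Z' ⟶ Z) : S.pull c (0 : S.Ext Z A) = 0 := by simp [pull]

variable [Preadditive C] [hS : S.IsExtriangulated]

lemma push_add {Z A A' : C} (a b : A ⟶ A') (δ : S.Ext Z A) :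
    S.push (a + b) δ = S.push a δ + S.push b δ := by
  have := hS.additive_right (op Z)
  simp [push, Functor.map_add]

lemma push_sub {Z A A' : C} (a b : A ⟶ A') (δ : S.Ext Z A) :
    S.push (a - b) δ = S.push a δ - S.push b δ := by
  rw [eq_sub_iff_add_eq, ← push_add, sub_add_cancel]

lemma pull_add {Z Z' A : C} (c d : Z' ⟶ Z) (δ : S.Ext Z A) :
    S.pull (c + d) δ = S.pull c δ + S.pull d δ := by
  have := hS.additive_left
  simp [pull, op_add, Functor.map_add]

/-- In an `E`-triangle `A --x--> B --y--> Z ⇢ δ` one has `δ · y = 0`. -/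
lemma pull_eq_zero {A B Z : C} (x : A ⟶ B) (y : B ⟶ Z) (δ : S.Ext Z A) (h : S.Realizes x y δ) :
    S.pull y δ = 0 := by
  have := hS.hasFiniteBiproducts
  have : HasZeroObject C := hasZeroObject_of_hasFiniteBiproducts C
  let b : BinaryBicone (0 : C) B :=
    { pt := B, fst := 0, snd := 𝟙 B, inl := 0, inr := 𝟙 B }
  have h0 := hS.realizes_zero b (isBinaryBilimitOfTotal b (by simp [b]))
  obtain ⟨a, ha, -⟩ := hS.et3op _ _ _ x y δ (𝟙 B) y h0 h rfl
  rw [← ha, push_zero]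

/-- If `g · δ = 0`, then `g` factors through `x`. -/
lemma exists_factor {A B Z : C} (x : A ⟶ B) (y : B ⟶ Z) (δ : S.Ext Z A) (h : S.Realizes x y δ)
    {K : C} (g : A ⟶ K) (hg : S.push g δ = 0) : ∃ t : B ⟶ K, x ≫ t = g := by
  have := hS.hasFiniteBiproducts
  have : HasZeroObject C := hasZeroObject_of_hasFiniteBiproducts C
  let b : BinaryBicone K (0 : C) :=
    { pt := K, fst := 𝟙 K, snd := 0, inl := 𝟙 K, inr := 0,
      inr_snd := (isZero_zero C).eq_of_src _ _ }
  have h0 := hS.realizes_zero b (isBinaryBilimitOfTotal b (by simp [b]))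
  obtain ⟨t, ht, -⟩ := hS.exists_middle x y δ _ _ _ g 0 h h0 (by rw [hg, pull_zero])
  exact ⟨t, by simpa [b] using ht⟩

lemma IsProjective.ext_eq_zero {P : C} (hP : S.IsProjective P) {A : C} (δ : S.Ext P A) :
    δ = 0 := by
  obtain ⟨B, x, y, h⟩ := hS.exists_realizes δ
  obtain ⟨s, hs⟩ := hP x y δ h (𝟙 P)
  rw [← S.pull_id δ, ← hs, pull_comp, S.pull_eq_zero x y δ h, pull_zero]

end pushpull

section syzygy

variable (S : ExtriData.{w} C) [hP : S.HasEnoughProjectives]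

/-- A chosen projective presentation `Ω M ⟶ P ⟶ M ⇢`. -/
def pres (M : C) : S.ProjPresentation M := (hP.presentation M).some

/-- The chosen syzygy of `M`. -/
abbrev Ω (M : C) : C := (S.pres M).K

/-- The class of the chosen presentation in `E(M, Ω M)`. -/
def θ (M : C) : S.Ext M (S.Ω M) := (S.pres M).δ

variable [Preadditive C] [hS : S.IsExtriangulated]

lemma exists_lift {M M' : C} (f : M ⟶ M') :
    ∃ g : S.Ω M ⟶ S.Ω M', S.push g (S.θ M) = S.pull f (S.θ M') := by
  obtain ⟨b, hb⟩ := (S.pres M).projective _ _ _ (S.pres M').realizes ((S.pres M).p ≫ f)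
  obtain ⟨g, hg, -⟩ := hS.et3op _ _ _ _ _ _ b f (S.pres M).realizes (S.pres M').realizes hb.symm
  exact ⟨g, hg⟩

/-- A chosen morphism `Ω f : Ω M ⟶ Ω M'` with `(Ω f, f)` a morphism of extensions. -/
def Ωmap {M M' : C} (f : M ⟶ M') : S.Ω M ⟶ S.Ω M' := (S.exists_lift f).choose

lemma Ωmap_spec {M M' : C} (f : M ⟶ M') :
    S.push (S.Ωmap f) (S.θ M) = S.pull f (S.θ M') := (S.exists_lift f).choose_spec

/-- An additive bifunctor vanishing on `E`-projectives in the first variable. -/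
structure StableBifunctor where
  F : Cᵒᵖ ⥤ C ⥤ AddCommGrpCat.{w}
  additive : F.Additive
  isZero : ∀ P : C, S.IsProjective P → IsZero (F.obj (op P))

variable {S}

lemma StableBifunctor.map_eq_zero (T : S.StableBifunctor) {M K : C} (g : S.Ω M ⟶ K)
    (hg : S.push g (S.θ M) = 0) : T.F.map g.op = 0 := by
  obtain ⟨t, rfl⟩ := S.exists_factor _ _ _ (S.pres M).realizes g hg
  rw [op_comp, T.F.map_comp,
    (T.isZero _ (S.pres M).projective).eq_of_tgt (T.F.map t.op) 0, zero_comp]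

lemma StableBifunctor.map_eq (T : S.StableBifunctor) {M K : C} (g g' : S.Ω M ⟶ K)
    (h : S.push g (S.θ M) = S.push g' (S.θ M)) : T.F.map g.op = T.F.map g'.op := by
  have := T.additive
  have := T.map_eq_zero (g - g') (by rw [push_sub, h, sub_self])
  rwa [op_sub, T.F.map_sub, sub_eq_zero] at this

/-- Dimension shift: the bifunctor `(M, N) ↦ F(Ω M, N)`. -/
def StableBifunctor.shift (T : S.StableBifunctor) : S.StableBifunctor where
  F :=
    { obj M := T.F.obj (op (S.Ω M.unop))
      map f := T.F.map (S.Ωmap f.unop).op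
      map_id M := by
        rw [T.map_eq _ (𝟙 _) (by rw [Ωmap_spec, push_id, unop_id, pull_id]), op_id, T.F.map_id]
      map_comp f g := by
        rw [← T.F.map_comp, ← op_comp]
        apply T.map_eq
        rw [Ωmap_spec, push_comp, Ωmap_spec, push_pull, Ωmap_spec, unop_comp, pull_comp] }
  additive :=
    { map_add {M M'} f g := by
        have := T.additive
        change T.F.map _ = T.F.map _ + T.F.map _
        rw [← T.F.map_add, ← op_add]
        apply T.map_eq
        rw [Ωmap_spec, push_add, Ωmap_spec, Ωmap_spec, unop_add, pull_add] }
  isZero Q hQ := by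
    rw [IsZero.iff_id_eq_zero]
    change 𝟙 (T.F.obj (op (S.Ω Q))) = 0
    rw [← T.F.map_id, ← op_id]
    exact T.map_eq_zero _ (IsProjective.ext_eq_zero S hQ _)

variable (S)

/-- The bifunctor `E` itself. -/
def stableE : S.StableBifunctor where
  F := S.E
  additive := hS.additive_left
  isZero P hP := by
    rw [IsZero.iff_id_eq_zero]
    ext A δ
    change δ = 0
    exact IsProjective.ext_eq_zero S hP δ

/-- The bifunctor `(M, N) ↦ E(Ωᵏ M, N)`. -/
def stableExt : ℕ → S.StableBifunctor
  | 0 => S.stableE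
  | k + 1 => (stableExt k).shift

/-- The higher extension bifunctor `Eⁱ(M, N) = E(Ωⁱ⁻¹ M, N)`, meaningful for `i ≥ 1`. -/
def higherExt (i : ℕ) : Cᵒᵖ ⥤ C ⥤ AddCommGrpCat.{w} := (S.stableExt (i - 1)).F

/-- `Eⁱ(M, N) = 0`. -/
def Vanishes (i : ℕ) (M N : C) : Prop := Subsingleton (((S.higherExt i).obj (op M)).obj N)

/-- The right orthogonal class `𝒳^{⊥_{≤ m}}`. -/
def rightPerp (m : ℕ) (X : ObjectProperty C) : ObjectProperty C :=
  fun N => ∀ j, 1 ≤ j → j ≤ m → ∀ M, X M → S.Vanishes j M N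

/-- The left orthogonal class `^{⊥_{≤ m}}𝒳`. -/
def leftPerp (m : ℕ) (X : ObjectProperty C) : ObjectProperty C :=
  fun M => ∀ j, 1 ≤ j → j ≤ m → ∀ N, X N → S.Vanishes j M N

/-- `𝒳` is `m`-rigid: `Eʲ(𝒳, 𝒳) = 0` for `1 ≤ j ≤ m - 1`. -/
def IsRigid (m : ℕ) (X : ObjectProperty C) : Prop :=
  ∀ j, 1 ≤ j → j < m → ∀ M N, X M → X N → S.Vanishes j M N

/-- The reduction of `C` at `𝒳` is the class `𝒳^{⊥_{≤ n+1}}`; it is considered for those `𝒳` for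
which this class equals `^{⊥_{≤ n+1}}𝒳`. -/
def reduction (n : ℕ) (X : ObjectProperty C) : ObjectProperty C := S.rightPerp (n + 1) X

end syzygy

/-- The restriction of `E` and `𝔰` to a full subcategory. -/
def restrict (S : ExtriData.{w} C) (D : ObjectProperty C) : ExtriData.{w} D.FullSubcategory where
  E := D.ι.op ⋙ S.E ⋙ (Functor.whiskeringLeft _ _ _).obj D.ι
  Realizes x y δ := S.Realizes (D.ι.map x) (D.ι.map y) δ

end ExtriData

/-- Every object has a right `𝒳`-approximation. -/
def IsPrecovering {C : Type u} [Category.{v} C] (X : ObjectProperty C) : Prop :=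
  ∀ M : C, ∃ (A : C) (f : A ⟶ M), X A ∧ ∀ A', X A' → ∀ g : A' ⟶ M, ∃ h : A' ⟶ A, h ≫ f = g

/-- Every object has a left `𝒳`-approximation. -/
def IsPreenveloping {C : Type u} [Category.{v} C] (X : ObjectProperty C) : Prop :=
  ∀ M : C, ∃ (A : C) (f : M ⟶ A), X A ∧ ∀ A', X A' → ∀ g : M ⟶ A', ∃ h : A ⟶ A', f ≫ h = g

/-- Functorially finite subcategories. -/
def IsFunctoriallyFinite {C : Type u} [Category.{v} C] (X : ObjectProperty C) : Prop :=
  IsPrecovering X ∧ IsPreenveloping X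

/-- The restriction of a bifunctor on `C` to a full subcategory. -/
def restrictBifunctor {C : Type u} [Category.{v} C] (D : ObjectProperty C)
    (F : Cᵒᵖ ⥤ C ⥤ AddCommGrpCat.{w}) :
    D.FullSubcategoryᵒᵖ ⥤ D.FullSubcategory ⥤ AddCommGrpCat.{w} :=
  D.ι.op ⋙ F ⋙ (Functor.whiskeringLeft _ _ _).obj D.ι

end Extri

end

/-! Write `R` for the reduction. It is extension-closed, so it inherits the extriangulated
structure. A right `X`-approximation `A ⟶ M` and a projective `P ⟶ M` combine to a deflation `A ⊞ P
⟶ M`, and for `M` in `R` its kernel stays in `R` (`exists_presentation`). As `E^j(A ⊞ P, N) = 0` for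
`N` in `R` and `1 ≤ j ≤ n + 1`, the objects `A ⊞ P` are projective in `R`. Every projective of `R`
is a retract of one of them, hence acyclic in this range.

Consequently syzygies in `R` compute the same groups. Put `T = E^(k+1)` and let `Ω_R M ⟶ Q ⟶ M` be a
presentation in `R`. In the exact sequence `T(Q) ⟶ T(Ω_R M) ⟶ T(Ω M) ⟶ T(Ω Q)` the ends are
extensions of `Q` of degrees `k + 1` and `k + 2`. When both vanish, `T(Ω_R M) ≅ T(Ω M)`, and
induction on the degree finishes (`shiftIso`).

The exact sequence comes from half exactness alone: a triangle `A ⟶ B ⟶ Z` rotates to `Ω Z ⟶ A ⊞ P ⟶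
B` (`exists_rotate`), and each rotation gives exactness one place further. Naturality holds because
the chosen maps between syzygies are ambiguous only up to maps through projectives, which `T` kills.
-/

noncomputable section

namespace Extri

namespace ExtriData

variable {C : Type u} [Category.{v} C] [Preadditive C]

/-! ### Exactness and rotation of `E`-triangles -/

section triangles

variable (S : ExtriData.{w} C) [hS : S.IsExtriangulated]

/-- If `δ · g = 0`, then `g` factors through `y`. -/
lemma exists_cofactor {A B Z : C} (x : A ⟶ B) (y : B ⟶ Z) (δ : S.Ext Z A) (h : S.Realizes x y δ)
    {K : C} (g : K ⟶ Z) (hg : S.pull g δ = 0) : ∃ t : K ⟶ B, t ≫ y = g := by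
  have := hS.hasFiniteBiproducts
  have : HasZeroObject C := hasZeroObject_of_hasFiniteBiproducts C
  let b : BinaryBicone (0 : C) K :=
    { pt := K, fst := 0, snd := 𝟙 K, inl := 0, inr := 𝟙 K }
  have h0 := hS.realizes_zero b (isBinaryBilimitOfTotal b (by simp [b]))
  obtain ⟨t, -, ht⟩ := hS.exists_middle _ _ _ x y δ 0 g h0 h (by rw [hg, push_zero])
  exact ⟨t, by simpa [b] using ht.symm⟩

/-- If `x · ε = 0`, then `ε` is the pullback of `δ` along a morphism. -/
lemma exists_pull_eq {A B Z : C} (x : A ⟶ B) (y : B ⟶ Z) (δ : S.Ext Z A) (h : S.Realizes x y δ)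
    {K : C} (ε : S.Ext K A) (hε : S.push x ε = 0) : ∃ g : K ⟶ Z, S.pull g δ = ε := by
  obtain ⟨W, m, e, hW⟩ := hS.exists_realizes ε
  obtain ⟨t, ht⟩ := S.exists_factor m e ε hW x hε
  obtain ⟨g, hg, -⟩ := hS.et3 m e ε x y δ (𝟙 A) t hW h (by simpa using ht)
  exact ⟨g, by rw [← hg, push_id]⟩

/-- If `ε · x = 0`, then `ε` is the pullback of an extension along `y`. -/
lemma exists_pull_right_eq {A B Z : C} (x : A ⟶ B) (y : B ⟶ Z) (δ : S.Ext Z A)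
    (h : S.Realizes x y δ) {N : C} (ε : S.Ext B N) (hε : S.pull x ε = 0) :
    ∃ ζ : S.Ext Z N, S.pull y ζ = ε := by
  obtain ⟨W, m, e, hW⟩ := hS.exists_realizes ε
  -- `H` is the kernel of the composite deflation `W ⟶ Z`, and an extension of `A` by `N` with class
  -- `ε · x = 0`. So `d` has a retraction, and pushing `δ''` along it gives `ζ`.
  obtain ⟨H, d, e', h', δ'', -, -, -, h4, -, h6⟩ := hS.et4op m e ε x y δ hW h
  rw [hε] at h4
  obtain ⟨r, hr⟩ := S.exists_factor d e' _ h4 (𝟙 N) (push_zero S _)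
  exact ⟨S.push r δ'', by rw [← push_pull, ← h6, ← push_comp, hr, push_id]⟩

/-- If `g` composes to zero with `y`, then it factors through `x`. -/
lemma exists_lift_of_comp_eq_zero {A B Z : C} (x : A ⟶ B) (y : B ⟶ Z) (δ : S.Ext Z A)
    (h : S.Realizes x y δ) {K : C} (g : K ⟶ B) (hg : g ≫ y = 0) : ∃ t : K ⟶ A, t ≫ x = g := by
  have := hS.hasFiniteBiproducts
  have : HasZeroObject C := hasZeroObject_of_hasFiniteBiproducts C
  let b : BinaryBicone K (0 : C) :=
    { pt := K, fst := 𝟙 K, snd := 0, inl := 𝟙 K, inr := 0,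
      inr_snd := (isZero_zero C).eq_of_src _ _ }
  have h0 := hS.realizes_zero b (isBinaryBilimitOfTotal b (by simp [b]))
  obtain ⟨t, -, ht⟩ := hS.et3op _ _ _ x y δ g 0 h0 h (by rw [hg, comp_zero])
  exact ⟨t, by simpa [b] using ht.symm⟩

/-- The difference `b - 𝟙` factors through `x` and is killed by precomposition with `x`, so it
squares to zero and `𝟙 - (b - 𝟙)` inverts `b`. -/
lemma isIso_of_comp_eq {A B Z : C} (x : A ⟶ B) (y : B ⟶ Z) (δ : S.Ext Z A)
    (h : S.Realizes x y δ) (b : B ⟶ B) (hx : x ≫ b = x) (hy : b ≫ y = y) : IsIso b := by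
  obtain ⟨t, ht⟩ := S.exists_lift_of_comp_eq_zero x y δ h (b - 𝟙 B) (by simp [hy])
  have hn : (b - 𝟙 B) ≫ (b - 𝟙 B) = 0 := by
    nth_rw 1 [← ht]
    simp [hx]
  simp only [Preadditive.comp_sub, Preadditive.sub_comp, Category.comp_id, Category.id_comp] at hn
  refine ⟨𝟙 B - (b - 𝟙 B), ?_, ?_⟩
  · simp only [Preadditive.comp_sub, Category.comp_id]
    rw [← sub_eq_zero, ← neg_eq_zero, ← hn]; abel
  · simp only [Preadditive.sub_comp, Category.id_comp]
    rw [← sub_eq_zero, ← neg_eq_zero, ← hn]; abel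

/-- Transport of an `E`-triangle along an isomorphism of its last term. -/
lemma realizes_comp_iso {A B Z Z' : C} (x : A ⟶ B) (y : B ⟶ Z) (δ : S.Ext Z A)
    (h : S.Realizes x y δ) (f : Z ≅ Z') : S.Realizes x (y ≫ f.hom) (S.pull f.inv δ) := by
  obtain ⟨B', x', y', h'⟩ := hS.exists_realizes (S.pull f.inv δ)
  obtain ⟨b, hb1, hb2⟩ := hS.exists_middle x y δ x' y' _ (𝟙 A) f.hom h h'
    (by rw [← pull_comp, f.hom_inv_id, pull_id, push_id])
  obtain ⟨b', hb1', hb2'⟩ := hS.exists_middle x' y' _ x y δ (𝟙 A) f.inv h' h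
    (by rw [push_id])
  rw [Category.id_comp] at hb1 hb1'
  -- The two middle morphisms need not be mutually inverse, but both composites are compatible with
  -- the identities at the ends. Hence both are invertible, and so is `b'`.
  have : IsIso (b ≫ b') := S.isIso_of_comp_eq x y δ h _ (by rw [reassoc_of% hb1, hb1'])
    (by rw [Category.assoc, ← hb2', ← reassoc_of% hb2, f.hom_inv_id, Category.comp_id])
  have : IsIso (b' ≫ b) := S.isIso_of_comp_eq x' y' _ h' _ (by rw [reassoc_of% hb1', hb1])
    (by rw [Category.assoc, ← hb2, ← reassoc_of% hb2', f.inv_hom_id, Category.comp_id])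
  have : IsSplitMono b' := IsSplitMono.mk' ⟨b ≫ inv (b' ≫ b), by
    rw [← Category.assoc, IsIso.hom_inv_id]⟩
  have : IsSplitEpi b' := IsSplitEpi.mk' ⟨inv (b ≫ b') ≫ b, by
    rw [Category.assoc, IsIso.inv_hom_id]⟩
  have : IsIso b' := isIso_of_mono_of_isSplitEpi b'
  have key := hS.realizes_of_equiv x' y' _ (asIso b') h'
  rw [asIso_hom, hb1', asIso_inv] at key
  convert key using 1
  rw [← cancel_epi b', IsIso.hom_inv_id_assoc, ← reassoc_of% hb2', f.inv_hom_id, Category.comp_id]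

/-- Rotation of an `E`-triangle `A ⟶ B ⟶ Z ⇢ δ`: if `δ` is the pushout of the extension `θ` along
`c`, then the middle term `P` of `θ` fits into an `E`-triangle `K ⟶ A ⊞ P ⟶ B`. -/
lemma exists_rotate [HasBinaryBiproducts C] {A B Z K P : C}
    (x : A ⟶ B) (y : B ⟶ Z) (δ : S.Ext Z A)
    (h : S.Realizes x y δ) (i : K ⟶ P) (p : P ⟶ Z) (θ : S.Ext Z K) (hθ : S.Realizes i p θ)
    (c : K ⟶ A) (hc : S.push c θ = δ) :
    ∃ h' : A ⊞ P ⟶ B, S.Realizes (biprod.lift c i) h' (S.pull y θ) ∧ biprod.inl ≫ h' = -x := by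
  have := hS.hasFiniteBiproducts
  have : HasZeroObject C := hasZeroObject_of_hasFiniteBiproducts C
  -- A twisted splitting of `A ⊞ K` with `K` embedded as the graph of `c`. The sign makes the
  -- projection to `A` kill this graph and restrict to `c` on `K`; it is the source of the sign in
  -- `-x`.
  let b₁ : BinaryBicone K A :=
    { pt := A ⊞ K, fst := biprod.snd, snd := -biprod.fst + biprod.snd ≫ c,
      inl := biprod.lift c (𝟙 K), inr := -biprod.inl }
  have r₁ := hS.realizes_zero b₁ (isBinaryBilimitOfTotal b₁ (by
    ext <;> simp [b₁]))
  let b₀ : BinaryBicone A (0 : C) :=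
    { pt := A, fst := 𝟙 A, snd := 0, inl := 𝟙 A, inr := 0,
      inr_snd := (isZero_zero C).eq_of_src _ _ }
  have r₀ := hS.realizes_zero b₀ (isBinaryBilimitOfTotal b₀ (by simp [b₀]))
  let b : BinaryBicone (0 : C) Z :=
    { pt := Z, fst := 0, snd := 𝟙 Z, inl := 0, inr := 𝟙 Z }
  have r₂ := hS.realizes_sum _ _ _ i p θ (BinaryBiproduct.bicone A K) (BinaryBiproduct.bicone A P) b
    (BinaryBiproduct.isBilimit A K) (BinaryBiproduct.isBilimit A P)
    (isBinaryBilimitOfTotal b (by simp [b])) r₀ hθ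
  -- The inflations `K ⟶ A ⊞ K ⟶ A ⊞ P` compose to `(c, i)`. Its cokernel `H` is an extension of `Z`
  -- by `A` with class `c · θ = δ`, hence isomorphic to `B`.
  obtain ⟨H, d, e, h', δ'', h1, -, h3, h4, -, h6⟩ := hS.et4 _ _ _ _ _ _ r₁ r₂
  have e4 : S.push b₁.snd (S.pull b.fst (S.push (BinaryBiproduct.bicone A K).inl
      (0 : S.Ext (0 : C) A)) + S.pull b.snd (S.push (BinaryBiproduct.bicone A K).inr θ)) = δ := by
    simp only [push_zero, pull_zero, zero_add]
    rw [show b.snd = 𝟙 Z from rfl, pull_id, ← push_comp,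
      show (BinaryBiproduct.bicone A K).inr ≫ b₁.snd = c by simp [b₁], hc]
  rw [e4] at h4
  have e6 : δ'' = S.pull e θ := by
    have := congrArg (S.push b₁.fst) h6
    rw [← push_comp, b₁.inl_fst, push_id] at this
    rw [this]
    simp only [push_zero, pull_zero, zero_add]
    rw [show b.snd = 𝟙 Z from rfl, pull_id, push_pull, ← push_comp,
      show (BinaryBiproduct.bicone A K).inr ≫ b₁.fst = 𝟙 K by simp [b₁], push_id]
  obtain ⟨f, hf1, hf2⟩ := hS.equiv_of_realizes _ _ _ _ _ h4 h
  refine ⟨h' ≫ f.hom, ?_, ?_⟩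
  · have key := S.realizes_comp_iso _ _ _ h3 f
    rw [e6, ← pull_comp, ← hf2, Iso.inv_hom_id_assoc] at key
    convert key using 1
    ext <;> simp [b₁, b₀]
  · have := congrArg (biprod.inl ≫ ·) h1
    simp only [b₁, b₀] at this
    rw [← hf1]
    simpa [b₀, ← Category.assoc, neg_eq_iff_eq_neg] using (congrArg (· ≫ f.hom) this).symm

/-- The morphism `(c, p) : A ⊞ P ⟶ Z` is a deflation if `p` is one. -/
lemma exists_realizes_desc [HasBinaryBiproducts C] {A Z K P : C} (i : K ⟶ P) (p : P ⟶ Z)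
    (θ : S.Ext Z K) (hθ : S.Realizes i p θ) (c : A ⟶ Z) :
    ∃ (H : C) (h' : H ⟶ A ⊞ P) (δ : S.Ext Z H), S.Realizes h' (biprod.desc c p) δ := by
  have := hS.hasFiniteBiproducts
  have : HasZeroObject C := hasZeroObject_of_hasFiniteBiproducts C
  -- `(c, p)` is `1 ⊕ p : A ⊞ P ⟶ A ⊞ Z` followed by the split deflation `(c, 1)`, so (ET4)ᵒᵖ
  -- applies.
  let b₁ : BinaryBicone A Z :=
    { pt := A ⊞ Z, fst := biprod.fst, snd := biprod.desc c (𝟙 Z),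
      inl := biprod.lift (𝟙 A) (-c), inr := biprod.inr }
  have r₁ := hS.realizes_zero b₁ (isBinaryBilimitOfTotal b₁ (by
    ext <;> simp [b₁]))
  let b₀ : BinaryBicone (0 : C) A :=
    { pt := A, fst := 0, snd := 𝟙 A, inl := 0, inr := 𝟙 A }
  have r₀ := hS.realizes_zero b₀ (isBinaryBilimitOfTotal b₀ (by simp [b₀]))
  let b : BinaryBicone (0 : C) K :=
    { pt := K, fst := 0, snd := 𝟙 K, inl := 0, inr := 𝟙 K }
  have r₂ := hS.realizes_sum _ _ _ i p θ b (BinaryBiproduct.bicone A P)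
    (BinaryBiproduct.bicone A Z) (isBinaryBilimitOfTotal b (by simp [b]))
    (BinaryBiproduct.isBilimit A P) (BinaryBiproduct.isBilimit A Z) r₀ hθ
  obtain ⟨H, d, e, h', δ'', -, -, h3, -⟩ := hS.et4op _ _ _ _ _ _ r₂ r₁
  refine ⟨H, h', δ'', ?_⟩
  convert h3 using 1
  ext <;> simp [b₁, b₀]

end triangles

end ExtriData

end Extri

end

noncomputable section

namespace Extri

namespace ExtriData

variable {C : Type u} [Category.{v} C] [Preadditive C]
  {S : ExtriData.{w} C}

/-! ### Long exact sequences in the first variable -/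

namespace StableBifunctor

/-- The action of a bifunctor on its first variable, on elements. -/
def res (T : S.StableBifunctor) {M M' N : C} (f : M ⟶ M')
    (t : (T.F.obj (op M')).obj N) : (T.F.obj (op M)).obj N :=
  ((T.F.map f.op).app N).hom t

variable (T : S.StableBifunctor) {M M' M'' N : C}

lemma res_id (t : (T.F.obj (op M)).obj N) : T.res (𝟙 M) t = t := by simp [res]

lemma res_comp (f : M ⟶ M') (g : M' ⟶ M'') (t : (T.F.obj (op M'')).obj N) :
    T.res (f ≫ g) t = T.res f (T.res g t) := by simp [res]

lemma res_zero (f : M ⟶ M') : T.res f (0 : (T.F.obj (op M')).obj N) = 0 := by simp [res]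

lemma res_sub (f : M ⟶ M') (t t' : (T.F.obj (op M')).obj N) :
    T.res f (t - t') = T.res f t - T.res f t' := by simp [res]

lemma res_neg (f : M ⟶ M') (t : (T.F.obj (op M')).obj N) :
    T.res f (-t) = -T.res f t := by simp [res]

lemma add_res (f g : M ⟶ M') (t : (T.F.obj (op M')).obj N) :
    T.res (f + g) t = T.res f t + T.res g t := by
  have := T.additive
  simp [res, op_add, Functor.map_add]

lemma neg_res (f : M ⟶ M') (t : (T.F.obj (op M')).obj N) :
    T.res (-f) t = -T.res f t := by
  have := T.additive
  simp [res, op_neg, Functor.map_neg]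

lemma subsingleton_of_isProjective {P : C} (h : S.IsProjective P) (N : C) :
    Subsingleton ((T.F.obj (op P)).obj N) := by
  refine ⟨fun a b ↦ ?_⟩
  have := congrArg (fun f : T.F.obj (op P) ⟶ T.F.obj (op P) ↦ f.app N)
    ((T.isZero P h).eq_of_src (𝟙 _) 0)
  have h0 (t : (T.F.obj (op P)).obj N) : t = 0 := congrArg (fun f ↦ f.hom t) this
  rw [h0 a, h0 b]

lemma subsingleton_of_retract (s : M ⟶ M') (r : M' ⟶ M) (h : s ≫ r = 𝟙 M)
    [Subsingleton ((T.F.obj (op M')).obj N)] : Subsingleton ((T.F.obj (op M)).obj N) :=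
  ⟨fun a b ↦ by
    rw [← T.res_id a, ← T.res_id b, ← h, res_comp, res_comp, Subsingleton.elim (T.res r a)]⟩

variable [hP : S.HasEnoughProjectives] [hS : S.IsExtriangulated]

/-- Exactness of `T(Z, N) ⟶ T(B, N) ⟶ T(A, N)` for every `E`-triangle `A ⟶ B ⟶ Z`. -/
def IsHalfExact : Prop :=
  ∀ {A B Z : C} (x : A ⟶ B) (y : B ⟶ Z) (δ : S.Ext Z A), S.Realizes x y δ →
    ∀ {N : C} (b : (T.F.obj (op B)).obj N), T.res x b = 0 →
      ∃ z : (T.F.obj (op Z)).obj N, T.res y z = b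

variable {T}

section connecting

variable {A B Z : C} (x : A ⟶ B) (y : B ⟶ Z) (δ : S.Ext Z A)

-- Projectivity of the middle term of the chosen presentation lifts `𝟙 Z` to a morphism of
-- triangles. Thus `θ` is universal among extensions of `Z`, and `c` plays the role of a connecting
-- morphism.
variable (S) in
lemma exists_connecting (δ : S.Ext Z A) : ∃ c : S.Ω Z ⟶ A, S.push c (S.θ Z) = δ := by
  obtain ⟨B, x, y, h⟩ := hS.exists_realizes δ
  obtain ⟨t, ht⟩ := (S.pres Z).projective _ _ _ h (S.pres Z).p
  obtain ⟨c, hc, -⟩ := hS.et3op _ _ _ _ _ _ t (𝟙 Z) (S.pres Z).realizes h (by simpa using ht.symm)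
  exact ⟨c, by rwa [pull_id] at hc⟩

/-- Exactness of `T(B, N) ⟶ T(A, N) ⟶ T(Ω Z, N)`. -/
lemma IsHalfExact.exact_connecting (hT : T.IsHalfExact) (h : S.Realizes x y δ) (c : S.Ω Z ⟶ A)
    (hc : S.push c (S.θ Z) = δ) (a : (T.F.obj (op A)).obj N) (ha : T.res c a = 0) :
    ∃ b : (T.F.obj (op B)).obj N, T.res x b = a := by
  have := hS.hasFiniteBiproducts
  have := HasBinaryBiproducts.of_hasBinaryProducts (C := C)
  obtain ⟨h', hr, hx⟩ := S.exists_rotate x y δ h _ _ _ (S.pres Z).realizes c hc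
  obtain ⟨b, hb⟩ := hT _ _ _ hr (T.res biprod.fst a) (by rw [← res_comp, biprod.lift_fst, ha])
  refine ⟨-b, ?_⟩
  rw [res_neg, ← neg_res, ← hx, res_comp, hb, ← res_comp, biprod.inl_fst, res_id]

/-- Exactness of `T(A, N) ⟶ T(Ω Z, N) ⟶ T(Ω B, N)`. -/
lemma IsHalfExact.exact_syzygy (hT : T.IsHalfExact) (h : S.Realizes x y δ) (c : S.Ω Z ⟶ A)
    (hc : S.push c (S.θ Z) = δ) (t : (T.F.obj (op (S.Ω Z))).obj N)
    (ht : T.res (S.Ωmap y) t = 0) : ∃ a : (T.F.obj (op A)).obj N, T.res c a = t := by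
  have := hS.hasFiniteBiproducts
  have := HasBinaryBiproducts.of_hasBinaryProducts (C := C)
  obtain ⟨h', hr, -⟩ := S.exists_rotate x y δ h _ _ _ (S.pres Z).realizes c hc
  -- The rotated triangle has class `θ · y`, so `S.Ωmap y` is a connecting morphism for it. The
  -- summand `P` of its middle term contributes nothing to `T`.
  obtain ⟨b, hb⟩ := hT.exact_connecting _ _ _ hr _ (S.Ωmap_spec y) t ht
  have := T.subsingleton_of_isProjective (S.pres Z).projective N
  refine ⟨T.res biprod.inl b, ?_⟩
  rw [← hb, ← T.res_id b, ← biprod.total, add_res, res_comp _ biprod.snd,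
    Subsingleton.elim (T.res biprod.inr b) 0, res_zero, add_zero, ← res_comp, ← res_comp,
    ← res_comp, biprod.lift_fst_assoc, Category.assoc,
    biprod.inl_fst_assoc]

/-- `T` half exact implies that its dimension shift is half exact. -/
lemma IsHalfExact.shift (hT : T.IsHalfExact) : T.shift.IsHalfExact := by
  intro A B Z x y δ h N t ht
  have := hS.hasFiniteBiproducts
  have := HasBinaryBiproducts.of_hasBinaryProducts (C := C)
  obtain ⟨c, hc⟩ := exists_connecting S δ
  obtain ⟨h', hr, hx⟩ := S.exists_rotate x y δ h _ _ _ (S.pres Z).realizes c hc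
  have := T.shift.subsingleton_of_isProjective (S.pres Z).projective N
  -- One more rotation: on `A ⊞ P` the shift of `T` sees only `A`, where `h'` is `-x`.
  refine hT.exact_syzygy _ _ _ hr _ (S.Ωmap_spec y) t ?_
  change T.shift.res h' t = 0
  rw [← Category.id_comp h', ← biprod.total, Preadditive.add_comp, add_res, Category.assoc, hx,
    Category.assoc, res_comp _ _ (biprod.inr ≫ h'), Subsingleton.elim (T.shift.res (biprod.inr ≫ h') t) 0,
    res_zero, add_zero, Preadditive.comp_neg, neg_res, res_comp, ht, res_zero, neg_zero]

end connecting

end StableBifunctor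

variable (S) [hP : S.HasEnoughProjectives] [hS : S.IsExtriangulated]

lemma stableExt_isHalfExact (k : ℕ) : (S.stableExt k).IsHalfExact := by
  induction k with
  | zero => exact fun x y δ h N b hb ↦ S.exists_pull_right_eq x y δ h b hb
  | succ k ih => exact ih.shift

end ExtriData

end Extri

end

noncomputable section

namespace Extri

namespace ExtriData

variable {C : Type u} [Category.{v} C] [Preadditive C]

/-! ### Extension-closed subcategories -/

section restrict

variable (D : ObjectProperty C)

lemma hasFiniteBiproducts_fullSubcategory [HasFiniteBiproducts C] (h0 : ∀ Z : C, IsZero Z → D Z)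
    (h2 : ∀ {A Z : C} (b : BinaryBicone A Z), b.IsBilimit → D A → D Z → D b.pt) :
    HasFiniteBiproducts D.FullSubcategory := by
  have := HasBinaryBiproducts.of_hasBinaryProducts (C := C)
  have : HasZeroObject C := hasZeroObject_of_hasFiniteBiproducts C
  have : HasZeroObject D.FullSubcategory :=
    ⟨⟨0, h0 _ (isZero_zero C)⟩, by
      rw [IsZero.iff_id_eq_zero]
      exact ObjectProperty.hom_ext _ ((isZero_zero C).eq_of_src _ _)⟩
  have : HasBinaryBiproducts D.FullSubcategory := ⟨fun A Z ↦ by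
    let b : BinaryBicone A Z :=
      { pt := ⟨A.obj ⊞ Z.obj,
          h2 _ (BinaryBiproduct.isBilimit A.obj Z.obj) A.property Z.property⟩
        fst := ObjectProperty.homMk biprod.fst
        snd := ObjectProperty.homMk biprod.snd
        inl := ObjectProperty.homMk biprod.inl
        inr := ObjectProperty.homMk biprod.inr
        inl_fst := by ext; simp
        inl_snd := by ext; exact biprod.inl_snd
        inr_fst := by ext; exact biprod.inr_fst
        inr_snd := by ext; simp }
    exact hasBinaryBiproduct_of_total b (ObjectProperty.hom_ext _ biprod.total)⟩
  have : HasFiniteProducts D.FullSubcategory := hasFiniteProducts_of_has_binary_and_terminal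
  exact HasFiniteBiproducts.of_hasFiniteProducts

/-- The image of a biproduct in a full subcategory is a biproduct. -/
def mapBicone {A Z : D.FullSubcategory} (b : BinaryBicone A Z) : BinaryBicone A.obj Z.obj where
  pt := b.pt.obj
  fst := b.fst.hom
  snd := b.snd.hom
  inl := b.inl.hom
  inr := b.inr.hom
  inl_fst := D.ι.congr_map b.inl_fst
  inl_snd := D.ι.congr_map b.inl_snd
  inr_fst := D.ι.congr_map b.inr_fst
  inr_snd := D.ι.congr_map b.inr_snd

lemma nonempty_isBilimit_mapBicone {A Z : D.FullSubcategory} (b : BinaryBicone A Z)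
    (hb : b.IsBilimit) : Nonempty (mapBicone D b).IsBilimit :=
  ⟨isBinaryBilimitOfTotal _ (D.ι.congr_map (IsBilimit.binary_total hb))⟩

variable (S : ExtriData.{w} C) [hS : S.IsExtriangulated]

/-- An extension-closed full subcategory containing the zero objects is extriangulated. -/
theorem isExtriangulated_restrict (h0 : ∀ Z : C, IsZero Z → D Z)
    (hD : ∀ {A B Z : C} (x : A ⟶ B) (y : B ⟶ Z) (δ : S.Ext Z A), S.Realizes x y δ →
      D A → D Z → D B) : (S.restrict D).IsExtriangulated where
  hasFiniteBiproducts :=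
    have := hS.hasFiniteBiproducts
    hasFiniteBiproducts_fullSubcategory D h0 fun b hb hA hZ ↦ hD _ _ _ (hS.realizes_zero b hb) hA hZ
  additive_left :=
    { map_add := fun {M M'} f g ↦ by
        have := hS.additive_left
        ext N t
        exact S.pull_add f.unop.hom g.unop.hom t }
  additive_right Z :=
    { map_add := fun {M M'} f g ↦ by
        ext t
        exact S.push_add f.hom g.hom t }
  exists_realizes {A Z} δ := by
    obtain ⟨B, x, y, h⟩ := hS.exists_realizes (A := A.obj) (Z := Z.obj) δ
    exact ⟨⟨B, hD x y _ h A.property Z.property⟩, ObjectProperty.homMk x,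
      ObjectProperty.homMk y, h⟩
  realizes_of_equiv x y δ b h :=
    hS.realizes_of_equiv x.hom y.hom δ (D.ι.mapIso b) h
  equiv_of_realizes x y x' y' δ h h' := by
    obtain ⟨b, hb, hb'⟩ := hS.equiv_of_realizes x.hom y.hom x'.hom y'.hom δ h h'
    exact ⟨D.isoMk b, by ext; exact hb, by ext; exact hb'⟩
  exists_middle x y δ x' y' δ' a c h h' e := by
    obtain ⟨b, hb, hb'⟩ := hS.exists_middle x.hom y.hom δ x'.hom y'.hom δ' a.hom c.hom h h' e
    exact ⟨ObjectProperty.homMk b, by ext; exact hb, by ext; exact hb'⟩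
  realizes_zero b hb :=
    hS.realizes_zero (mapBicone D b) (nonempty_isBilimit_mapBicone D b hb).some
  realizes_sum x y δ x' y' δ' bA bB bZ hA hB hZ h h' :=
    hS.realizes_sum x.hom y.hom δ x'.hom y'.hom δ' (mapBicone D bA) (mapBicone D bB)
      (mapBicone D bZ) (nonempty_isBilimit_mapBicone D bA hA).some
      (nonempty_isBilimit_mapBicone D bB hB).some (nonempty_isBilimit_mapBicone D bZ hZ).some h h'
  et3 x y δ x' y' δ' a b h h' e := by
    obtain ⟨c, hc, hc'⟩ := hS.et3 x.hom y.hom δ x'.hom y'.hom δ' a.hom b.hom h h'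
      (D.ι.congr_map e)
    exact ⟨ObjectProperty.homMk c, hc, by ext; exact hc'⟩
  et3op x y δ x' y' δ' b c h h' e := by
    obtain ⟨a, ha, ha'⟩ := hS.et3op x.hom y.hom δ x'.hom y'.hom δ' b.hom c.hom h h'
      (D.ι.congr_map e)
    exact ⟨ObjectProperty.homMk a, ha, by ext; exact ha'⟩
  et4 {A B Y G F} f f' δ g g' δ' h h' := by
    obtain ⟨H, d, e, k, δ'', h1, h2, h3, h4, h5, h6⟩ :=
      hS.et4 f.hom f'.hom δ g.hom g'.hom δ' h h'
    -- The new object `H` lies in `D` because it is an extension of `F` by `Y`.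
    exact ⟨⟨H, hD _ _ _ h4 Y.property F.property⟩, ObjectProperty.homMk d, ObjectProperty.homMk e,
      ObjectProperty.homMk k, δ'', by ext; exact h1, by ext; exact h2, h3, h4, h5, h6⟩
  et4op {A B Y G F} f' f δ g' g δ' h h' := by
    obtain ⟨H, d, e, k, δ'', h1, h2, h3, h4, h5, h6⟩ :=
      hS.et4op f'.hom f.hom δ g'.hom g.hom δ' h h'
    exact ⟨⟨H, hD _ _ _ h4 Y.property F.property⟩, ObjectProperty.homMk d, ObjectProperty.homMk e,
      ObjectProperty.homMk k, δ'', by ext; exact h1, by ext; exact h2, h3, h4, h5, h6⟩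

end restrict

end ExtriData

end Extri

end

noncomputable section

namespace Extri

namespace ExtriData

variable {C : Type u} [Category.{v} C] [Preadditive C]

/-! ### Projectives of the reduction -/

section reduction

variable {S : ExtriData.{w} C}

lemma StableBifunctor.IsHalfExact.subsingleton {T : S.StableBifunctor} (hT : T.IsHalfExact)
    {A B Z : C} (x : A ⟶ B) (y : B ⟶ Z) (δ : S.Ext Z A) (h : S.Realizes x y δ) (N : C)
    [Subsingleton ((T.F.obj (op A)).obj N)] [Subsingleton ((T.F.obj (op Z)).obj N)] :
    Subsingleton ((T.F.obj (op B)).obj N) :=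
  subsingleton_of_forall_eq 0 fun b ↦ by
    obtain ⟨z, rfl⟩ := hT x y δ h b (Subsingleton.elim _ _)
    rw [Subsingleton.elim z 0, T.res_zero]

lemma isProjective_of_isZero {Z : C} (h : IsZero Z) : S.IsProjective Z :=
  fun _ _ _ _ _ ↦ ⟨0, h.eq_of_src _ _⟩

/-- Exactness of `Hom(Y, B) ⟶ Hom(Y, Z) ⟶ E(Y, A) ⟶ E(Y, B)`: the first map is onto and the last
group is zero. -/
lemma subsingleton_ext_of_lift [hS : S.IsExtriangulated] {A B Z Y : C} {x : A ⟶ B} {y : B ⟶ Z} {δ : S.Ext Z A}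
    (h : S.Realizes x y δ) [Subsingleton (S.Ext Y B)]
    (hY : ∀ g : Y ⟶ Z, ∃ t : Y ⟶ B, t ≫ y = g) : Subsingleton (S.Ext Y A) :=
  subsingleton_of_forall_eq 0 fun ε ↦ by
    obtain ⟨g, rfl⟩ := S.exists_pull_eq x y δ h ε (Subsingleton.elim _ _)
    obtain ⟨t, rfl⟩ := hY g
    rw [pull_comp, S.pull_eq_zero x y δ h, pull_zero]

variable (S) [hP : S.HasEnoughProjectives] [hS : S.IsExtriangulated]

lemma stableExt_obj (k : ℕ) (M : C) :
    (S.stableExt k).F.obj (op M) = S.E.obj (op (S.Ω^[k] M)) := by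
  induction k generalizing M with
  | zero => rfl
  | succ k ih => exact ih (S.Ω M)

lemma vanishes_succ_iff (k : ℕ) (M N : C) :
    S.Vanishes (k + 1) M N ↔ Subsingleton (S.Ext (S.Ω^[k] M) N) := by
  rw [Vanishes, higherExt, Nat.add_sub_cancel, stableExt_obj]

variable {S}

lemma IsProjective.vanishes {P : C} (h : S.IsProjective P) (j : ℕ) (N : C) :
    S.Vanishes j P N :=
  (S.stableExt (j - 1)).subsingleton_of_isProjective h N

lemma Vanishes.of_realizes {A B Z : C} {x : A ⟶ B} {y : B ⟶ Z} {δ : S.Ext Z A}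
    (h : S.Realizes x y δ) {j : ℕ} {N : C} (hA : S.Vanishes j A N) (hZ : S.Vanishes j Z N) :
    S.Vanishes j B N := by
  have : Subsingleton (((S.stableExt (j - 1)).F.obj (op A)).obj N) := hA
  have : Subsingleton (((S.stableExt (j - 1)).F.obj (op Z)).obj N) := hZ
  exact StableBifunctor.IsHalfExact.subsingleton (S.stableExt_isHalfExact (j - 1)) x y δ h N

lemma Vanishes.biprod [HasBinaryBiproducts C] {A Z N : C} {j : ℕ} (hA : S.Vanishes j A N)
    (hZ : S.Vanishes j Z N) : S.Vanishes j (A ⊞ Z) N :=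
  hA.of_realizes (hS.realizes_zero _ (BinaryBiproduct.isBilimit A Z)) hZ

lemma Vanishes.of_retract {M M' N : C} {j : ℕ} (hM : S.Vanishes j M' N) (s : M ⟶ M') (r : M' ⟶ M)
    (h : s ≫ r = 𝟙 M) : S.Vanishes j M N := by
  have : Subsingleton (((S.stableExt (j - 1)).F.obj (op M')).obj N) := hM
  exact (S.stableExt (j - 1)).subsingleton_of_retract s r h

lemma leftPerp_of_realizes {m : ℕ} {X : ObjectProperty C} {A B Z : C} {x : A ⟶ B} {y : B ⟶ Z}
    {δ : S.Ext Z A} (h : S.Realizes x y δ) (hA : S.leftPerp m X A) (hZ : S.leftPerp m X Z) :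
    S.leftPerp m X B :=
  fun j h1 h2 N hN ↦ (hA j h1 h2 N hN).of_realizes h (hZ j h1 h2 N hN)

lemma IsProjective.leftPerp {m : ℕ} {X : ObjectProperty C} {P : C} (h : S.IsProjective P) :
    S.leftPerp m X P :=
  fun j _ _ N _ ↦ h.vanishes j N

/-- As `E(Y, Z) = 0`, the morphism `g` extends to the projective middle term of the presentation of
`Y`, and from there it lifts through `y`. -/
lemma exists_lift_syzygy {A B Z Y : C} {x : A ⟶ B} {y : B ⟶ Z} {δ : S.Ext Z A}
    (h : S.Realizes x y δ) [Subsingleton (S.Ext Y Z)] (g : S.Ω Y ⟶ Z) :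
    ∃ t : S.Ω Y ⟶ B, t ≫ y = g := by
  obtain ⟨t, rfl⟩ := S.exists_factor _ _ _ (S.pres Y).realizes g (Subsingleton.elim _ _)
  obtain ⟨t', rfl⟩ := (S.pres Y).projective x y δ h t
  exact ⟨(S.pres Y).i ≫ t', Category.assoc _ _ _⟩

variable {n : ℕ} {X : ObjectProperty C}

lemma reduction_of_mem (hX : S.IsRigid (n + 2) X) {A : C} (hA : X A) : S.reduction n X A :=
  fun j h1 h2 M hM ↦ hX j h1 (by omega) M A hM hA

/-- Half exactness is in the first variable, so the left orthogonal description is the one that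
gives closure under extensions. -/
lemma reduction_of_realizes (hperp : S.rightPerp (n + 1) X = S.leftPerp (n + 1) X)
    {A B Z : C} {x : A ⟶ B} {y : B ⟶ Z} {δ : S.Ext Z A} (h : S.Realizes x y δ)
    (hA : S.reduction n X A) (hZ : S.reduction n X Z) : S.reduction n X B := by
  unfold reduction at *
  rw [hperp] at *
  exact leftPerp_of_realizes h hA hZ

lemma IsProjective.reduction (hperp : S.rightPerp (n + 1) X = S.leftPerp (n + 1) X) {P : C}
    (h : S.IsProjective P) : S.reduction n X P := by
  unfold ExtriData.reduction
  rw [hperp]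
  exact h.leftPerp

lemma isExtriangulated_reduction (hperp : S.rightPerp (n + 1) X = S.leftPerp (n + 1) X) :
    (S.restrict (S.reduction n X)).IsExtriangulated :=
  S.isExtriangulated_restrict _ (fun _ hZ ↦ IsProjective.reduction hperp (isProjective_of_isZero hZ))
    fun _ _ _ h ↦ reduction_of_realizes hperp h

/-- The kernel of a right approximation by the sum of an object of `𝒳` and a projective object
lies in the reduction. -/
lemma exists_presentation [HasBinaryBiproducts C] (hX : S.IsRigid (n + 2) X) (hc : IsPrecovering X)
    (hperp : S.rightPerp (n + 1) X = S.leftPerp (n + 1) X) {M : C} (hM : S.reduction n X M) :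
    ∃ (A P K : C) (i : K ⟶ A ⊞ P) (p : A ⊞ P ⟶ M) (δ : S.Ext M K), X A ∧ S.IsProjective P ∧
      S.reduction n X (A ⊞ P) ∧ S.reduction n X K ∧ S.Realizes i p δ := by
  obtain ⟨A, f, hA, hf⟩ := hc M
  obtain ⟨K, i, δ, h⟩ := S.exists_realizes_desc _ _ _ (S.pres M).realizes f
  have hQ : S.reduction n X (A ⊞ (S.pres M).P) :=
    reduction_of_realizes hperp (hS.realizes_zero _ (BinaryBiproduct.isBilimit _ _))
      (reduction_of_mem hX hA) (IsProjective.reduction hperp (S.pres M).projective)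
  refine ⟨A, _, K, i, _, δ, hA, (S.pres M).projective, hQ, fun j h1 h2 Y hY ↦ ?_, h⟩
  obtain ⟨k, rfl⟩ := Nat.exists_eq_add_of_le' h1
  have hQ' := hQ (k + 1) h1 h2 Y hY
  rw [vanishes_succ_iff] at hQ' ⊢
  cases k with
  | zero =>
    -- Degree one is where the approximation property enters: any `Y ⟶ M` with `Y` in `X` factors
    -- through `A`.
    refine subsingleton_ext_of_lift h fun g ↦ ?_
    obtain ⟨t, rfl⟩ := hf Y hY g
    exact ⟨t ≫ biprod.inl, by simp⟩
  | succ k =>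
    -- Degree `k + 2` of `K` is squeezed between degree `k + 1` of `M` and degree `k + 2` of `A ⊞
    -- P`.
    have hM' := hM (k + 1) (by omega) (by omega) Y hY
    rw [vanishes_succ_iff] at hM'
    rw [Function.iterate_succ_apply'] at hQ' ⊢
    exact subsingleton_ext_of_lift h fun g ↦ exists_lift_syzygy h g

lemma vanishes_biprod [HasBinaryBiproducts C] {A P N : C} (hA : X A) (hP : S.IsProjective P)
    (hN : S.reduction n X N) {j : ℕ} (h1 : 1 ≤ j) (h2 : j ≤ n + 1) : S.Vanishes j (A ⊞ P) N :=
  (hN j h1 h2 A hA).biprod (hP.vanishes j N)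

/-- Since `E(A ⊞ P, -)` vanishes on the reduction, every pullback of an extension there to `A ⊞ P`
is zero, so `A ⊞ P` is projective in the reduction. -/
lemma hasEnoughProjectives_reduction (hX : S.IsRigid (n + 2) X) (hc : IsPrecovering X)
    (hperp : S.rightPerp (n + 1) X = S.leftPerp (n + 1) X) :
    (S.restrict (S.reduction n X)).HasEnoughProjectives where
  presentation M := by
    have := hS.hasFiniteBiproducts
    have := HasBinaryBiproducts.of_hasBinaryProducts (C := C)
    obtain ⟨A, P, K, i, p, δ, hA, hP, hQ, hK, h⟩ := exists_presentation hX hc hperp M.property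
    refine ⟨⟨⟨K, hK⟩, ⟨A ⊞ P, hQ⟩, ObjectProperty.homMk i, ObjectProperty.homMk p, δ, h, ?_⟩⟩
    intro A' B' Z' x y δ' h' f
    have := (vanishes_biprod hA hP A'.property le_rfl (by omega) : S.Vanishes 1 (A ⊞ P) A'.obj)
    obtain ⟨t, ht⟩ := S.exists_cofactor x.hom y.hom δ' h' f.hom
      (((S.vanishes_succ_iff 0 _ _).1 this).elim _ _)
    exact ⟨ObjectProperty.homMk t, ObjectProperty.hom_ext _ ht⟩

/-- The projectives of the reduction are acyclic in the range `1 ≤ j ≤ n + 1`. -/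
lemma vanishes_of_isProjective_restrict (hX : S.IsRigid (n + 2) X) (hc : IsPrecovering X)
    (hperp : S.rightPerp (n + 1) X = S.leftPerp (n + 1) X)
    {Q N : (S.reduction n X).FullSubcategory} (hQ : (S.restrict (S.reduction n X)).IsProjective Q)
    {j : ℕ} (h1 : 1 ≤ j) (h2 : j ≤ n + 1) : S.Vanishes j Q.obj N.obj := by
  have := hS.hasFiniteBiproducts
  have := HasBinaryBiproducts.of_hasBinaryProducts (C := C)
  obtain ⟨A, P, K, i, p, δ, hA, hP, hQ', hK, h⟩ := exists_presentation hX hc hperp Q.property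
  -- The whole presentation lies in the reduction, so it splits and `Q` is a retract of `A ⊞ P`.
  obtain ⟨s, hs⟩ := hQ (A := ⟨K, hK⟩) (B := ⟨A ⊞ P, hQ'⟩) (Z := Q) (ObjectProperty.homMk i)
    (ObjectProperty.homMk p) δ h (𝟙 Q)
  exact (vanishes_biprod hA hP N.property h1 h2).of_retract s.hom p
    ((S.reduction n X).ι.congr_map hs)

end reduction

/-! ### Comparison of syzygies -/

section comparison

variable (S : ExtriData.{w} C) [hP : S.HasEnoughProjectives] [hS : S.IsExtriangulated]
  (D : ObjectProperty C) [hPD : (S.restrict D).HasEnoughProjectives]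

/-- A chosen comparison morphism from the syzygy in `C` to the syzygy in a full subcategory. -/
def syzygyComparison (M : D.FullSubcategory) : S.Ω M.obj ⟶ ((S.restrict D).Ω M).obj :=
  (StableBifunctor.exists_connecting S
    (Z := M.obj) (A := ((S.restrict D).Ω M).obj) ((S.restrict D).θ M)).choose

lemma push_syzygyComparison (M : D.FullSubcategory) :
    S.push (S.syzygyComparison D M) (S.θ M.obj) = (S.restrict D).θ M :=
  (StableBifunctor.exists_connecting S
    (Z := M.obj) (A := ((S.restrict D).Ω M).obj) ((S.restrict D).θ M)).choose_spec

variable {S D}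

/-- The square of syzygies need not commute in `C`, but both composites push `θ` to the same
extension, and that is all `T` detects. -/
lemma StableBifunctor.map_syzygyComparison [hD : (S.restrict D).IsExtriangulated]
    (T : S.StableBifunctor) {M M' : D.FullSubcategory} (f : M ⟶ M') :
    T.F.map ((S.restrict D).Ωmap f).hom.op ≫ T.F.map (S.syzygyComparison D M).op =
      T.F.map (S.syzygyComparison D M').op ≫ T.F.map (S.Ωmap f.hom).op := by
  rw [← T.F.map_comp, ← T.F.map_comp, ← op_comp, ← op_comp]
  apply T.map_eq
  rw [push_comp, push_comp, push_syzygyComparison, Ωmap_spec, push_pull, push_syzygyComparison]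
  exact (S.restrict D).Ωmap_spec f

/-- With `Q` the middle term of the presentation in `D`, `T(Q) = 0` gives injectivity and `T(Ω Q) =
0` gives surjectivity. -/
lemma StableBifunctor.IsHalfExact.bijective_res_syzygyComparison {T : S.StableBifunctor}
    (hT : T.IsHalfExact) (M : D.FullSubcategory) (N : C)
    [Subsingleton ((T.F.obj (op ((S.restrict D).pres M).P.obj)).obj N)]
    [Subsingleton ((T.shift.F.obj (op ((S.restrict D).pres M).P.obj)).obj N)] :
    Function.Bijective (T.res (N := N) (S.syzygyComparison D M)) := by
  have h : S.Realizes ((S.restrict D).pres M).i.hom ((S.restrict D).pres M).p.hom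
    ((S.restrict D).θ M) := ((S.restrict D).pres M).realizes
  refine ⟨fun a b hab ↦ ?_, fun t ↦ ?_⟩
  · obtain ⟨z, hz⟩ := hT.exact_connecting _ _ _ h _ (S.push_syzygyComparison D M) (a - b)
      (by rw [res_sub, hab, sub_self])
    rwa [Subsingleton.elim z 0, res_zero, eq_comm, sub_eq_zero] at hz
  · exact hT.exact_syzygy _ _ _ h _ (S.push_syzygyComparison D M) t
      (Subsingleton.elim (α := (T.shift.F.obj (op ((S.restrict D).pres M).P.obj)).obj N) _ _)

lemma StableBifunctor.IsHalfExact.isIso_whiskerLeft_syzygyComparison {T : S.StableBifunctor}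
    (hT : T.IsHalfExact) (M : D.FullSubcategory)
    (h0 : ∀ N : D.FullSubcategory,
      Subsingleton ((T.F.obj (op ((S.restrict D).pres M).P.obj)).obj N.obj))
    (h1 : ∀ N : D.FullSubcategory,
      Subsingleton ((T.shift.F.obj (op ((S.restrict D).pres M).P.obj)).obj N.obj)) :
    IsIso (Functor.whiskerLeft D.ι (T.F.map (S.syzygyComparison D M).op)) := by
  have (N : D.FullSubcategory) : IsIso ((Functor.whiskerLeft D.ι
      (T.F.map (S.syzygyComparison D M).op)).app N) := by
    have := h0 N
    have := h1 N
    rw [ConcreteCategory.isIso_iff_bijective]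
    exact hT.bijective_res_syzygyComparison M N.obj
  exact NatIso.isIso_of_isIso_app _

/-- Over a full subcategory whose projectives are `T`-acyclic and acyclic for the shift of `T`, the
dimension shift formed with syzygies in the subcategory is the restriction of the one in `C`. -/
def shiftIso [hD : (S.restrict D).IsExtriangulated] {T : S.StableBifunctor} (hT : T.IsHalfExact)
    (h0 : ∀ M N : D.FullSubcategory,
      Subsingleton ((T.F.obj (op ((S.restrict D).pres M).P.obj)).obj N.obj))
    (h1 : ∀ M N : D.FullSubcategory,
      Subsingleton ((T.shift.F.obj (op ((S.restrict D).pres M).P.obj)).obj N.obj))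
    {T' : (S.restrict D).StableBifunctor} (φ : T'.F ≅ restrictBifunctor D T.F) :
    T'.shift.F ≅ restrictBifunctor D T.shift.F :=
  NatIso.ofComponents
    (fun M ↦
      have := hT.isIso_whiskerLeft_syzygyComparison M.unop (h0 M.unop) (h1 M.unop)
      φ.app (op ((S.restrict D).Ω M.unop)) ≪≫
        @asIso _ _ _ _ (Functor.whiskerLeft D.ι (T.F.map (S.syzygyComparison D M.unop).op)) this)
    (fun {M M'} f ↦ by
      have e1 := φ.hom.naturality ((S.restrict D).Ωmap f.unop).op
      have e2 := congrArg (Functor.whiskerLeft D.ι) (T.map_syzygyComparison f.unop)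
      rw [Functor.whiskerLeft_comp, Functor.whiskerLeft_comp] at e2
      exact (Category.assoc _ _ _).symm.trans ((congrArg (· ≫ Functor.whiskerLeft D.ι
        (T.F.map (S.syzygyComparison D M'.unop).op)) e1).trans ((Category.assoc _ _ _).trans
        ((congrArg (φ.hom.app _ ≫ ·) e2).trans (Category.assoc _ _ _).symm))))

end comparison

end ExtriData

end Extri

end

theorem mainTheorem2 {C : Type u} [Category.{v} C] [Preadditive C]
    (S : Extri.ExtriData.{w} C) [S.IsExtriangulated]
    [S.HasEnoughProjectives] [S.HasEnoughInjectives]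
    (n : ℕ) (X : ObjectProperty C)
    (hrigid : S.IsRigid (n + 2) X)
    (hff : Extri.IsFunctoriallyFinite X)
    (hperp : S.rightPerp (n + 1) X = S.leftPerp (n + 1) X) :
    ∃ (_ : (S.restrict (S.reduction n X)).IsExtriangulated)
      (_ : (S.restrict (S.reduction n X)).HasEnoughProjectives),
      ∀ i : ℕ, 1 ≤ i → i ≤ n + 1 →
        Nonempty ((S.restrict (S.reduction n X)).higherExt i ≅
          Extri.restrictBifunctor (S.reduction n X) (S.higherExt i)) := by
  have hD := Extri.ExtriData.isExtriangulated_reduction hperp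
  have hPD := Extri.ExtriData.hasEnoughProjectives_reduction hrigid hff.1 hperp
  refine ⟨hD, hPD, fun i h1 h2 ↦ ?_⟩
  obtain ⟨k, rfl⟩ := Nat.exists_eq_add_of_le' h1
  change Nonempty (((S.restrict (S.reduction n X)).stableExt k).F ≅
    Extri.restrictBifunctor (S.reduction n X) (S.stableExt k).F)
  induction k with
  | zero => exact ⟨Iso.refl _⟩
  | succ k ih =>
    obtain ⟨φ⟩ := ih (by omega) (by omega)
    -- `S.stableExt k` is the extension bifunctor of degree `k + 1`, so the two acyclicity
    -- conditions have degrees `k + 1` and `k + 2`, both at most `n + 1`.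
    exact ⟨Extri.ExtriData.shiftIso (S.stableExt_isHalfExact k)
      (fun M N ↦ Extri.ExtriData.vanishes_of_isProjective_restrict hrigid hff.1 hperp (N := N)
        ((S.restrict (S.reduction n X)).pres M).projective (j := k + 1) (by omega) (by omega))
      (fun M N ↦ Extri.ExtriData.vanishes_of_isProjective_restrict hrigid hff.1 hperp (N := N)
        ((S.restrict (S.reduction n X)).pres M).projective (j := k + 2) (by omega) (by omega)) φ⟩
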